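/- **Theorem 1 (Long-Run Beliefs).** Let $M\in\mathbb R^{D\times L}$ have rank $L$ (so $D\ge L$), let $f\in\mathbb R^L$, and let $\Sigma\in\mathbb R^{D\times D}$ be (symmetric) positive definite. In each period $t=1,2,\dots$ an agent observes the signal $r_t=Mf+\epsilon_t$, where $\epsilon_1,\epsilon_2,\dots$ are independent and normally distributed with mean $0$ and covariance matrix $\Sigma$. The agent has a prior $\mathbf P_0$, a Borel probability measure on the space of pairs $(f',\Sigma')$ with $f'\in\mathbb R^L$ and $\Sigma'\in\mathbb R^{D\times D}$ positive definite (with its usual topology as a subspace of $\mathbb R^L\times\mathbb R^{D\times D}$), and updates it by Bayes' rule: $$\mathbf P_t A=\frac{\int \mathbf 1_{(f',\Sigma')\in A}\,\ell_t(f',\Sigma')\,d\mathbf P_0(f',\Sigma')}{\int \ell_t(f',\Sigma')\,d\mathbf P_0(f',\Sigma')},\qquad \ell_t(f',\Sigma')=\prod_{z=1}^t\frac{1}{\sqrt{(2\pi)^D\det\Sigma'}}\exp\Big(-\tfrac12 (r_z-Mf')^T(\Sigma')^{-1}(r_z-Mf')\Big).$$ Beliefs *concentrate on a point* $(\tilde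 f,\tilde\Sigma)$ if $\lim_{t\to\infty}\mathbf P_tA=1$ for every open set $A$ containing $(\tilde f,\tilde\Sigma)$. Fix an index $i\in\{1,\dots,L\}$ and a number $\tilde f_i\in\mathbb R$ (the agent's dogmatic belief about fundamental $i$, which may differ from $f_i$). Let the support of $\mathbf P_0$ in this space be one of the following sets: * Case I: $\{(f',\Sigma'): f'_i=\tilde f_i,\ \Sigma'=\tilde\Sigma\}$ for a given positive definite $\tilde\Sigma$; * Case II: $\{(f',\Sigma'): f'=\tilde f\}$ for a given $\tilde f\in\mathbb R^L$ with $i$-th coordinate $\tilde f_i$; * Case III: $\{(f',\Sigma'): f'_i=\tilde f_i\}$. In each case, almost surely, the agent's beliefs concentrate on exactly one point $(\tilde f,\tilde\Sigma)$, which is deterministic. Furthermore: * Case I: $\tilde\Sigma$ is the given matrix and, for every $j$, $$\tilde f_j-f_j=\frac{\big[(M^T\tilde\Sigma^{-1}M)^{-1}\big]_{ij}}{\big[(M^T\tilde\Sigma^{-1}M)^{-1}\big]_{ii}}\,(\tilde f_i-f_i).$$ * Case II: $\tilde f$ is the given vector and $\tilde\Sigma-\Sigma=(M(\tilde f-f))(M(\tilde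 f-f))^T$. * Case III: for every $j$, $$\tilde f_j-f_j=\frac{\big[(M^T\Sigma^{-1}M)^{-1}\big]_{ji}}{\big[(M^T\Sigma^{-1}M)^{-1}\big]_{ii}}\,(\tilde f_i-f_i),$$ and $\tilde\Sigma-\Sigma=(M(\tilde f-f))(M(\tilde f-f))^T$. In particular, the long-run belief $\tilde f$ about the fundamentals coincides with the one in Case I when the covariance matrix is fixed at the true $\Sigma$. -/

import Mathlib

open MeasureTheory ProbabilityTheory Filter Topology
open scoped Matrix ENNReal

/-- Entrywise (= Borel) measurable structure on real matrices. -/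
instance instMeasurableSpaceRealMatrix {m n : Type*} : MeasurableSpace (Matrix m n ℝ) :=
  inferInstanceAs (MeasurableSpace (m → n → ℝ))

instance instBorelSpaceRealMatrix {m n : Type*} [Countable m] [Countable n] :
    BorelSpace (Matrix m n ℝ) :=
  inferInstanceAs (BorelSpace (m → n → ℝ))

/-- The set of (symmetric) positive definite `D × D` real matrices, with the subspace topology. -/
abbrev CovMatrix (D : ℕ) : Type := {S : Matrix (Fin D) (Fin D) ℝ // S.PosDef}

/-- The parameter space: pairs of a vector of fundamentals and a covariance matrix. -/
abbrev Param (L D : ℕ) : Type := (Fin L → ℝ) × CovMatrix D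

/-- Density at `x` of the normal law on `ℝ^D` with mean `m` and covariance matrix `S`. -/
noncomputable def normalDensity {D : ℕ} (m : Fin D → ℝ) (S : CovMatrix D) (x : Fin D → ℝ) : ℝ :=
  (Real.sqrt ((2 * Real.pi) ^ D * S.1.det))⁻¹ *
    Real.exp (-(1 / 2) * ((x - m) ⬝ᵥ (S.1⁻¹ *ᵥ (x - m))))

/-- Likelihood of the first `t` signals `r 0, …, r (t - 1)` under the parameters `θ`. -/
noncomputable def likelihood {L D : ℕ} (M : Matrix (Fin D) (Fin L) ℝ) (r : ℕ → Fin D → ℝ)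
    (t : ℕ) (θ : Param L D) : ℝ :=
  ∏ z ∈ Finset.range t, normalDensity (M *ᵥ θ.1) θ.2 (r z)

/-- Posterior probability of `A` after the first `t` signals, by Bayes' rule from the prior `P₀`.
The integrals are Lebesgue integrals with values in `[0, ∞]`. (If the normalising integral is
infinite, the quotient is `0` by convention; so a limit equal to `1` includes the assertion
that the posterior is eventually well defined.) -/
noncomputable def posterior {L D : ℕ} (M : Matrix (Fin D) (Fin L) ℝ) (P₀ : Measure (Param L D))
    (r : ℕ → Fin D → ℝ) (t : ℕ) (A : Set (Param L D)) : ℝ≥0∞ :=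
  (∫⁻ θ in A, ENNReal.ofReal (likelihood M r t θ) ∂P₀) /
    (∫⁻ θ, ENNReal.ofReal (likelihood M r t θ) ∂P₀)

/-- Along the signal sequence `r`, beliefs concentrate on the point `θ`: every open set
containing `θ` has posterior probability tending to `1`. -/
def ConcentratesOn {L D : ℕ} (M : Matrix (Fin D) (Fin L) ℝ) (P₀ : Measure (Param L D))
    (r : ℕ → Fin D → ℝ) (θ : Param L D) : Prop :=
  ∀ A : Set (Param L D), IsOpen A → θ ∈ A →
    Tendsto (fun t : ℕ => posterior M P₀ r t A) atTop (𝓝 1)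

/-- The signals `r_t = M f + ε_t` realised in the state of the world `ω`. -/
def signal {L D : ℕ} {Ω : Type*} (M : Matrix (Fin D) (Fin L) ℝ) (f : Fin L → ℝ)
    (ε : ℕ → Ω → EuclideanSpace ℝ (Fin D)) (ω : Ω) : ℕ → Fin D → ℝ :=
  fun t => M *ᵥ f + (ε t ω).ofLp

/-- Almost surely, `θ` is the one and only point on which the beliefs concentrate. -/
def IsLongRunBelief {L D : ℕ} {Ω : Type*} [MeasurableSpace Ω] (P : Measure Ω)
    (M : Matrix (Fin D) (Fin L) ℝ) (f : Fin L → ℝ) (ε : ℕ → Ω → EuclideanSpace ℝ (Fin D))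
    (P₀ : Measure (Param L D)) (θ : Param L D) : Prop :=
  ∀ᵐ ω ∂P, ∀ θ' : Param L D, ConcentratesOn M P₀ (signal M f ε ω) θ' ↔ θ' = θ

/-! Up to the factor `-t/2` and an additive constant, the log-likelihood of `(f', Σ')` after `t`
signals is `log det Σ' + tr (Σ'⁻¹ (C + v vᵀ))` with `v = e + M (f' - f)` up to the sign of `f' - f`,
where `e` and `C` are the empirical mean and covariance of the noise (`likelihood_eq_exp`). By the
strong law `(C, e) → (Σ, 0)` almost surely, so the posterior is an exponential weight that piles up
at a strict minimiser of the limiting loss on the support (`concentratesOn_of_tendsto`). The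
parameter space is not compact; what replaces compactness is that sublevel sets of the loss are
compact, locally uniformly in `(C, e)`.

The minimisation is deterministic. For fixed `Σ'` the loss is a constant plus the quadratic form of
`Mᵀ Σ'⁻¹ M` at `f' - f`, minimised on the hyperplane where `f'_i` is prescribed. For fixed `f'`,
Stein's inequality `PosDef.log_det_add_card_le` singles out `Σ' = Σ + v vᵀ` with `v = M (f' - f)`.
By the matrix determinant lemma the remaining loss increases with the quadratic form of `Mᵀ Σ⁻¹ M`,
so the joint problem has the fundamentals of the problem with known `Σ`. -/

open Matrix

/-! ### Stein's loss, determinants and traces of positive definite matrices -/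

namespace Matrix

section SteinLoss

variable {n : Type*} [Fintype n]

theorem trace_mul_vecMulVec (A : Matrix n n ℝ) (u v : n → ℝ) :
    (A * vecMulVec u v).trace = v ⬝ᵥ (A *ᵥ u) := by
  rw [mul_vecMulVec, trace_vecMulVec, dotProduct_comm]

theorem PosDef.add_vecMulVec_self {A : Matrix n n ℝ} (hA : A.PosDef) (v : n → ℝ) :
    (A + vecMulVec v v).PosDef :=
  hA.add_posSemidef (posSemidef_vecMulVec_self_star v)

variable [DecidableEq n]

theorem PosDef.log_det_eq_sum_log_eigenvalues {X : Matrix n n ℝ} (hX : X.PosDef) :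
    Real.log X.det = ∑ k, Real.log (hX.1.eigenvalues k) := by
  rw [hX.1.det_eq_prod_eigenvalues]
  simp only [RCLike.ofReal_real_eq_id, id]
  exact Real.log_prod fun k _ => (hX.eigenvalues_pos k).ne'

theorem PosDef.log_det_add_card_le_trace {X : Matrix n n ℝ} (hX : X.PosDef) :
    Real.log X.det + Fintype.card n ≤ X.trace := by
  rw [hX.log_det_eq_sum_log_eigenvalues, hX.1.trace_eq_sum_eigenvalues]
  have h : ∑ k, (Real.log (hX.1.eigenvalues k) + 1) ≤ ∑ k, hX.1.eigenvalues k :=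
    Finset.sum_le_sum fun k _ => by
      linarith [Real.log_le_sub_one_of_pos (hX.eigenvalues_pos k)]
  simpa [Finset.sum_add_distrib] using h

/-- The inequality `log a ≤ a - 1` is strict unless `a = 1`, so every eigenvalue is `1`. -/
theorem PosDef.eq_one_of_trace_le {X : Matrix n n ℝ} (hX : X.PosDef)
    (h : X.trace ≤ Real.log X.det + Fintype.card n) : X = 1 := by
  have h1 : ∀ k, hX.1.eigenvalues k = 1 := by
    by_contra! hne
    obtain ⟨k, hk⟩ := hne
    have hlt : ∑ k, (Real.log (hX.1.eigenvalues k) + 1) < ∑ k, hX.1.eigenvalues k :=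
      Finset.sum_lt_sum (fun k _ => by
        linarith [Real.log_le_sub_one_of_pos (hX.eigenvalues_pos k)])
        ⟨k, Finset.mem_univ _, by
          linarith [Real.log_lt_sub_one_of_pos (hX.eigenvalues_pos k) hk]⟩
    rw [hX.log_det_eq_sum_log_eigenvalues, hX.1.trace_eq_sum_eigenvalues] at h
    simp only [Finset.sum_add_distrib, Finset.sum_const, Finset.card_univ, nsmul_eq_mul,
      mul_one] at hlt
    simp only [RCLike.ofReal_real_eq_id, id] at h
    linarith
  have h2 : (RCLike.ofReal ∘ hX.1.eigenvalues : n → ℝ) = fun _ => 1 := by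
    ext k; simp [h1]
  rw [hX.1.spectral_theorem, h2, diagonal_one, map_one]

theorem PosDef.exists_conjTranspose_mul_self {A : Matrix n n ℝ} (hA : A.PosDef) :
    ∃ B : Matrix n n ℝ, IsUnit B ∧ A = Bᴴ * B := by
  open scoped MatrixOrder in
  obtain ⟨B, hB⟩ := CStarAlgebra.nonneg_iff_eq_star_mul_self.mp hA.posSemidef.nonneg
  refine ⟨B, ?_, hB⟩
  have h := hA.isUnit
  rw [hB] at h
  rw [isUnit_iff_isUnit_det] at h ⊢
  rw [det_mul] at h
  exact isUnit_of_mul_isUnit_right h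

/-- Stein's loss is nonnegative, and vanishes only for equal matrices. -/
theorem PosDef.log_det_add_card_le {Q T : Matrix n n ℝ} (hQ : Q.PosDef) (hT : T.PosDef) :
    Real.log T.det + Fintype.card n ≤ Real.log Q.det + (Q⁻¹ * T).trace ∧
      (Real.log Q.det + (Q⁻¹ * T).trace ≤ Real.log T.det + Fintype.card n → Q = T) := by
  -- `Q⁻¹ * T` need not be symmetric; `B * T * Bᴴ` is, and has the same trace and determinant.
  obtain ⟨B, hB, hQB⟩ := hQ.inv.exists_conjTranspose_mul_self
  have hX : (B * T * Bᴴ).PosDef :=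
    hT.mul_mul_conjTranspose_same (vecMul_injective_iff_isUnit.2 hB)
  have htr : (B * T * Bᴴ).trace = (Q⁻¹ * T).trace := by
    rw [hQB, Matrix.trace_mul_comm, ← Matrix.mul_assoc]
  have hQdet : Q⁻¹.det = Q.det⁻¹ := by rw [det_nonsing_inv, Ring.inverse_eq_inv']
  have hdet : (B * T * Bᴴ).det = T.det * Q.det⁻¹ := by
    rw [← hQdet, hQB]; simp only [det_mul]; ring
  have hlog : Real.log (B * T * Bᴴ).det = Real.log T.det - Real.log Q.det := by
    rw [hdet, Real.log_mul hT.det_pos.ne' (inv_ne_zero hQ.det_pos.ne'), Real.log_inv]; ring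
  refine ⟨?_, fun h => ?_⟩
  · have := hX.log_det_add_card_le_trace
    rw [htr, hlog] at this
    linarith
  · have h1 : B * T * Bᴴ = 1 := hX.eq_one_of_trace_le (by rw [htr, hlog]; linarith)
    have h2 : T * Bᴴ * B = 1 := by
      rw [Matrix.mul_assoc] at h1
      exact mul_eq_one_comm.1 h1
    rw [Matrix.mul_assoc, ← hQB] at h2
    have hu : IsUnit Q.det := (isUnit_iff_isUnit_det _).1 hQ.isUnit
    calc Q = T * Q⁻¹ * Q := by rw [h2, Matrix.one_mul]
      _ = T := by rw [Matrix.mul_assoc, nonsing_inv_mul _ hu, Matrix.mul_one]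

theorem det_add_vecMulVec {A : Matrix n n ℝ} (hA : IsUnit A.det) (u v : n → ℝ) :
    (A + vecMulVec u v).det = A.det * (1 + v ⬝ᵥ (A⁻¹ *ᵥ u)) := by
  rw [vecMulVec_eq Unit, det_add_replicateCol_mul_replicateRow hA, det_unique (n := Unit),
    Matrix.mul_assoc, ← replicateCol_mulVec]
  simp [Matrix.replicateRow_mul_replicateCol_apply]

theorem PosDef.trace_mul_nonneg {A B : Matrix n n ℝ} (hA : A.PosDef) (hB : B.PosSemidef) :
    0 ≤ (A * B).trace := by
  obtain ⟨R, -, rfl⟩ := hA.exists_conjTranspose_mul_self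
  have := (hB.mul_mul_conjTranspose_same R).trace_nonneg
  rwa [Matrix.trace_mul_comm, ← Matrix.mul_assoc] at this

theorem PosSemidef.abs_apply_le_trace {A : Matrix n n ℝ} (hA : A.PosSemidef) (j k : n) :
    |A j k| ≤ A.trace := by
  have hd : ∀ i, A i i ≤ A.trace := fun i =>
    Finset.single_le_sum (f := fun i => A i i) (fun i _ => hA.diag_nonneg) (Finset.mem_univ i)
  have hs : A k j = A j k := by simpa using hA.1.apply j k
  -- With `c = ±1` this gives `|A j k| ≤ (A j j + A k k) / 2`.
  have key : ∀ c : ℝ, 0 ≤ A j j + 2 * c * A j k + c * c * A k k := fun c => by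
    have := hA.dotProduct_mulVec_nonneg (Pi.single j 1 + c • Pi.single k 1)
    simp only [star_trivial, mulVec_add, mulVec_smul, mulVec_single_one, add_dotProduct,
      dotProduct_add, smul_dotProduct, dotProduct_smul, single_one_dotProduct, smul_eq_mul,
      col_apply, hs] at this
    linarith
  rw [abs_le]
  constructor <;> linarith [key 1, key (-1), hd j, hd k]

end SteinLoss

end Matrix

/-! ### Topology of the cone of positive definite matrices -/

namespace Matrix

theorem continuousAt_inv_of_det_ne_zero {n : Type*} [Fintype n] [DecidableEq n]
    {A : Matrix n n ℝ} (h : A.det ≠ 0) : ContinuousAt Inv.inv A :=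
  continuousAt_matrix_inv A (by
    rw [Ring.inverse_eq_inv']
    exact continuousAt_inv₀ h)

theorem isClosed_setOf_posSemidef {n : Type*} [Fintype n] :
    IsClosed {A : Matrix n n ℝ | A.PosSemidef} := by
  have : {A : Matrix n n ℝ | A.PosSemidef} =
      {A | Aᴴ = A} ∩ ⋂ x : n → ℝ, {A | 0 ≤ star x ⬝ᵥ (A *ᵥ x)} := by
    ext A
    simp only [Set.mem_ofPred_eq, Set.mem_inter_iff, Set.mem_iInter,
      posSemidef_iff_dotProduct_mulVec, IsHermitian]
  rw [this]
  refine (isClosed_eq continuous_id.matrix_conjTranspose continuous_id).inter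
    (isClosed_iInter fun x => isClosed_le continuous_const ?_)
  exact continuous_const.dotProduct (continuous_id.matrix_mulVec continuous_const)

/-- Positivity on the compact unit sphere survives small perturbations, and homogeneity extends it
to all nonzero vectors. -/
theorem PosDef.eventually_posDef {n : Type*} [Fintype n] {S : Matrix n n ℝ} (hS : S.PosDef) :
    ∀ᶠ C in 𝓝 S, C.IsHermitian → C.PosDef := by
  have h : ∀ᶠ C in 𝓝 S, ∀ x ∈ Metric.sphere (0 : n → ℝ) 1, 0 < x ⬝ᵥ (C *ᵥ x) := by
    refine (isCompact_sphere _ _).eventually_forall_of_forall_eventually fun x hx => ?_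
    have hc : Continuous fun z : Matrix n n ℝ × (n → ℝ) => z.2 ⬝ᵥ (z.1 *ᵥ z.2) :=
      continuous_snd.dotProduct (continuous_fst.matrix_mulVec continuous_snd)
    refine hc.continuousAt.eventually (lt_mem_nhds ?_)
    have hx0 : x ≠ 0 := by rintro rfl; simp at hx
    simpa using hS.dotProduct_mulVec_pos hx0
  filter_upwards [h] with C hC hH
  refine .of_dotProduct_mulVec_pos hH fun x hx => ?_
  have hn : 0 < ‖x‖ := norm_pos_iff.2 hx
  have := hC (‖x‖⁻¹ • x) (by simp [norm_smul, hn.ne'])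
  rw [mulVec_smul, smul_dotProduct, dotProduct_smul, smul_smul, smul_eq_mul] at this
  rw [star_trivial]
  exact (pos_iff_pos_of_mul_pos this).1 (by positivity)

theorem PosDef.exists_eventually_sub_smul_one_posDef {n : Type*} [Fintype n] [DecidableEq n]
    {S : Matrix n n ℝ} (hS : S.PosDef) :
    ∃ c : ℝ, 0 < c ∧ ∀ᶠ C in 𝓝 S, C.IsHermitian → (C - c • (1 : Matrix n n ℝ)).PosDef := by
  have hc : Continuous fun z : Matrix n n ℝ × ℝ => z.1 - z.2 • (1 : Matrix n n ℝ) := by fun_prop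
  have h : ∀ᶠ z : Matrix n n ℝ × ℝ in 𝓝 S ×ˢ 𝓝 0,
      (z.1 - z.2 • (1 : Matrix n n ℝ)).IsHermitian → (z.1 - z.2 • (1 : Matrix n n ℝ)).PosDef := by
    rw [← nhds_prod_eq]
    refine (hc.tendsto (S, 0)).eventually (p := fun C => C.IsHermitian → C.PosDef) ?_
    simpa using hS.eventually_posDef
  obtain ⟨pa, hpa, pb, hpb, hp⟩ := eventually_prod_iff.1 h
  obtain ⟨c, hcb, hc0⟩ :=
    ((hpb.filter_mono nhdsWithin_le_nhds).and (self_mem_nhdsWithin (s := Set.Ioi (0 : ℝ)))).exists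
  refine ⟨c, hc0, hpa.mono fun C hC hH => hp hC hcb (hH.sub ?_)⟩
  simp [IsHermitian]

end Matrix

section CovMatrix

variable {D : ℕ}

theorem CovMatrix.det_pos (Q : CovMatrix D) : 0 < Q.1.det := Q.2.det_pos

theorem CovMatrix.continuous_inv : Continuous fun Q : CovMatrix D => Q.1⁻¹ :=
  continuous_iff_continuousAt.2 fun Q =>
    (continuousAt_inv_of_det_ne_zero Q.det_pos.ne').comp continuous_subtype_val.continuousAt

/-- For `A = Q⁻¹`, the trace bounds all entries and the determinant keeps `A` off the singular
boundary, so the set is the image of a compact set under inversion. -/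
theorem CovMatrix.isCompact_setOf_trace_inv_le {a : ℝ} (ha : 0 < a) (b : ℝ) :
    IsCompact {Q : CovMatrix D | Q.1⁻¹.trace ≤ b ∧ a ≤ Q.1⁻¹.det} := by
  set K : Set (Matrix (Fin D) (Fin D) ℝ) :=
    {A | A.PosSemidef} ∩ ({A | A.trace ≤ b} ∩ {A | a ≤ A.det}) with hKdef
  have hK : IsCompact K := by
    have hbox : IsCompact (Set.matrix (Set.Icc (-b) b) : Set (Matrix (Fin D) (Fin D) ℝ)) :=
      isCompact_Icc.matrix
    refine hbox.of_isClosed_subset (isClosed_setOf_posSemidef.inter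
      ((isClosed_le (continuous_id.matrix_trace) continuous_const).inter
        (isClosed_le continuous_const continuous_id.matrix_det))) ?_
    rintro A ⟨hA, hb, -⟩ i j
    exact abs_le.1 ((hA.abs_apply_le_trace i j).trans hb)
  have hpd : ∀ A ∈ K, A.PosDef := fun A hA =>
    hA.1.posDef_iff_det_ne_zero.2 (ha.trans_le hA.2.2).ne'
  rw [Subtype.isCompact_iff]
  convert hK.image_of_continuousOn (f := Inv.inv) fun A hA =>
    (continuousAt_inv_of_det_ne_zero (hpd A hA).det_pos.ne').continuousWithinAt using 1
  ext Q
  constructor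
  · rintro ⟨Q, ⟨h1, h2⟩, rfl⟩
    exact ⟨Q.1⁻¹, ⟨Q.2.inv.posSemidef, h1, h2⟩,
      nonsing_inv_nonsing_inv _ ((isUnit_iff_isUnit_det _).1 Q.2.isUnit)⟩
  · rintro ⟨A, hA, rfl⟩
    refine ⟨⟨A⁻¹, (hpd A hA).inv⟩, ?_, rfl⟩
    simp only [Set.mem_ofPred_eq,
      nonsing_inv_nonsing_inv _ ((isUnit_iff_isUnit_det _).1 (hpd A hA).isUnit)]
    exact hA.2

end CovMatrix

/-! ### The Gaussian loss: coercivity and separation from the minimum -/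

section Loss

variable {L D : ℕ}

/-- The Gaussian negative log-likelihood per observation (doubled, up to an additive constant) of
the parameters `θ`, when the noise has empirical mean `e` and empirical covariance `C`, and the
signals are `M f` plus noise. -/
noncomputable def gaussianLoss (M : Matrix (Fin D) (Fin L) ℝ) (f : Fin L → ℝ)
    (C : Matrix (Fin D) (Fin D) ℝ) (e : Fin D → ℝ) (θ : Param L D) : ℝ :=
  Real.log θ.2.1.det +
    (θ.2.1⁻¹ * (C + vecMulVec (e + M *ᵥ (f - θ.1)) (e + M *ᵥ (f - θ.1)))).trace

theorem continuous_gaussianLoss (M : Matrix (Fin D) (Fin L) ℝ) (f : Fin L → ℝ) :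
    Continuous fun z : (Matrix (Fin D) (Fin D) ℝ × (Fin D → ℝ)) × Param L D =>
      gaussianLoss M f z.1.1 z.1.2 z.2 := by
  unfold gaussianLoss
  have hv : Continuous fun z : (Matrix (Fin D) (Fin D) ℝ × (Fin D → ℝ)) × Param L D =>
      z.1.2 + M *ᵥ (f - z.2.1) :=
    (continuous_snd.comp continuous_fst).add (continuous_const.matrix_mulVec
      (continuous_const.sub (continuous_fst.comp continuous_snd)))
  have hdet : Continuous fun z : (Matrix (Fin D) (Fin D) ℝ × (Fin D → ℝ)) × Param L D =>
      z.2.2.1.det :=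
    (continuous_subtype_val.comp (continuous_snd.comp continuous_snd)).matrix_det
  refine (hdet.log fun z => z.2.2.det_pos.ne').add ?_
  exact ((CovMatrix.continuous_inv.comp (continuous_snd.comp continuous_snd)).matrix_mul
    ((continuous_fst.comp continuous_fst).add (hv.matrix_vecMulVec hv))).matrix_trace

/-- Split `C + v vᵀ` as `(C - 2c) + c + (c + v vᵀ)`. The first part has nonnegative trace against
`Σ'⁻¹`, the second gives `c * tr Σ'⁻¹`, and Stein's inequality applies to the third. -/
theorem gaussianLoss_lower_bound (M : Matrix (Fin D) (Fin L) ℝ) (f : Fin L → ℝ)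
    {C : Matrix (Fin D) (Fin D) ℝ} {c : ℝ} (hc : 0 < c)
    (hC : (C - (2 * c) • (1 : Matrix (Fin D) (Fin D) ℝ)).PosSemidef) (e : Fin D → ℝ)
    (θ : Param L D) :
    c * θ.2.1⁻¹.trace + (D * Real.log c + D) +
      Real.log (1 + c⁻¹ * ((e + M *ᵥ (f - θ.1)) ⬝ᵥ (e + M *ᵥ (f - θ.1))))
        ≤ gaussianLoss M f C e θ := by
  set v := e + M *ᵥ (f - θ.1) with hv
  have hone : (c • (1 : Matrix (Fin D) (Fin D) ℝ)).PosDef := PosDef.one.smul hc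
  have hdet1 : (c • (1 : Matrix (Fin D) (Fin D) ℝ)).det = c ^ D := by simp
  have hinv : (c • (1 : Matrix (Fin D) (Fin D) ℝ))⁻¹ = c⁻¹ • 1 := by
    refine inv_eq_right_inv ?_
    simp [smul_smul, hc.ne']
  have hdet : (c • (1 : Matrix (Fin D) (Fin D) ℝ) + vecMulVec v v).det
      = c ^ D * (1 + c⁻¹ * (v ⬝ᵥ v)) := by
    rw [det_add_vecMulVec ((isUnit_iff_isUnit_det _).1 hone.isUnit), hdet1, hinv, smul_mulVec,
      one_mulVec, dotProduct_smul, smul_eq_mul]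
  have hvv : 0 ≤ v ⬝ᵥ v := by simpa using dotProduct_star_self_nonneg v
  have h1 := (θ.2.2.log_det_add_card_le (hone.add_vecMulVec_self v)).1
  rw [hdet, Real.log_mul (by positivity) (by positivity), Real.log_pow, Fintype.card_fin] at h1
  have h2 := θ.2.2.inv.trace_mul_nonneg hC
  have h3 : C + vecMulVec v v = (C - (2 * c) • 1) + c • 1 + (c • 1 + vecMulVec v v) := by
    rw [two_mul, add_smul]; abel
  have h4 : (θ.2.1⁻¹ * (c • (1 : Matrix (Fin D) (Fin D) ℝ))).trace = c * θ.2.1⁻¹.trace := by simp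
  rw [gaussianLoss, ← hv, h3, Matrix.mul_add, Matrix.mul_add, trace_add, trace_add, h4]
  linarith

/-- This bound prevents `Σ'` from escaping to infinity. -/
theorem neg_log_det_inv_le_gaussianLoss (M : Matrix (Fin D) (Fin L) ℝ) (f : Fin L → ℝ)
    {C : Matrix (Fin D) (Fin D) ℝ} (hC : C.PosSemidef) (e : Fin D → ℝ) (θ : Param L D) :
    -Real.log θ.2.1⁻¹.det ≤ gaussianLoss M f C e θ := by
  have h := θ.2.2.inv.trace_mul_nonneg (hC.add (posSemidef_vecMulVec_self_star
    (e + M *ᵥ (f - θ.1))))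
  rw [star_trivial] at h
  rw [gaussianLoss, det_nonsing_inv, Ring.inverse_eq_inv', Real.log_inv]
  linarith

/-- The sublevel sets of the loss are compact, locally uniformly in the empirical moments. -/
theorem exists_isCompact_eventually_lt_gaussianLoss {M : Matrix (Fin D) (Fin L) ℝ}
    (hM : Function.Injective M.mulVec) (f : Fin L → ℝ) (S : CovMatrix D) (B : ℝ) :
    ∃ Q : Set (Param L D), IsCompact Q ∧
      ∀ᶠ z in 𝓝 (S.1, (0 : Fin D → ℝ)), z.1.IsHermitian →
        ∀ θ, θ ∉ Q → B < gaussianLoss M f z.1 z.2 θ := by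
  obtain ⟨c', hc', hev⟩ := S.2.exists_eventually_sub_smul_one_posDef
  obtain ⟨c, rfl⟩ : ∃ c, c' = 2 * c := ⟨c' / 2, by ring⟩
  have hc : 0 < c := by linarith
  obtain ⟨k, hk, hlip⟩ := M.mulVecLin.exists_antilipschitzWith (LinearMap.ker_eq_bot.2 hM)
  set B1 : ℝ := B - (D * Real.log c + D) with hB1
  -- Here `‖e‖ < 1`, and `‖v‖ ≤ 1 + c * exp B1` comes from `|v i| ≤ 1 + v i ^ 2`; `k` passes from `M
  -- (f - f')` back to `f - f'`.
  set R : ℝ := ‖f‖ + k * (1 + (1 + c * Real.exp B1)) with hR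
  refine ⟨Metric.closedBall 0 R ×ˢ {Q | Q.1⁻¹.trace ≤ c⁻¹ * B1 ∧ Real.exp (-B) ≤ Q.1⁻¹.det},
    (isCompact_closedBall 0 R).prod
      (CovMatrix.isCompact_setOf_trace_inv_le (Real.exp_pos _) _), ?_⟩
  rw [nhds_prod_eq]
  have he : ∀ᶠ e : Fin D → ℝ in 𝓝 0, ‖e‖ < 1 :=
    (continuous_norm.tendsto' _ _ norm_zero).eventually (gt_mem_nhds one_pos)
  filter_upwards [hev.prod_mk he] with z hz hH θ
  obtain ⟨hz1, hz2⟩ := hz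
  have hpd := hz1 hH
  contrapose!
  intro hle
  have hl := gaussianLoss_lower_bound M f hc hpd.posSemidef z.2 θ
  set v := z.2 + M *ᵥ (f - θ.1) with hv
  have hvv : 0 ≤ v ⬝ᵥ v := by simpa using dotProduct_star_self_nonneg v
  have hlog : 0 ≤ Real.log (1 + c⁻¹ * (v ⬝ᵥ v)) := Real.log_nonneg (by
    have : 0 ≤ c⁻¹ * (v ⬝ᵥ v) := by positivity
    linarith)
  have htr : 0 ≤ c * θ.2.1⁻¹.trace := mul_nonneg hc.le θ.2.2.inv.posSemidef.trace_nonneg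
  have hC : z.1.PosSemidef := by
    have := hpd.posSemidef.add ((PosSemidef.one (n := Fin D) (R := ℝ)).smul hc'.le)
    simpa using this
  have hdet := neg_log_det_inv_le_gaussianLoss M f hC z.2 θ
  refine ⟨?_, ?_, ?_⟩
  · rw [mem_closedBall_zero_iff]
    have h1 : v ⬝ᵥ v ≤ c * Real.exp B1 := by
      have h2 : Real.log (1 + c⁻¹ * (v ⬝ᵥ v)) ≤ B1 := by linarith
      have h3 := (Real.log_le_iff_le_exp (by positivity)).1 h2
      have h4 : c⁻¹ * (v ⬝ᵥ v) ≤ Real.exp B1 := by linarith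
      rwa [inv_mul_le_iff₀ hc] at h4
    have h5 : ‖v‖ ≤ 1 + c * Real.exp B1 := by
      rw [pi_norm_le_iff_of_nonneg (by positivity)]
      intro i
      have h6 : v i * v i ≤ v ⬝ᵥ v :=
        Finset.single_le_sum (f := fun i => v i * v i) (fun i _ => mul_self_nonneg _)
          (Finset.mem_univ i)
      rw [Real.norm_eq_abs]
      nlinarith [sq_abs (v i), sq_nonneg (|v i| - 1), abs_nonneg (v i)]
    have h7 : ‖M *ᵥ (f - θ.1)‖ ≤ 1 + (1 + c * Real.exp B1) := by
      have : M *ᵥ (f - θ.1) = v - z.2 := by rw [hv]; abel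
      rw [this]
      linarith [norm_sub_le v z.2]
    have h8 : ‖f - θ.1‖ ≤ k * ‖M *ᵥ (f - θ.1)‖ := by
      simpa only [add_zero, norm_neg, map_zero, mulVecLin_apply] using hlip.le_mul_norm_sub (f - θ.1) 0
    have h9 : ‖θ.1‖ ≤ ‖f‖ + ‖f - θ.1‖ := by
      have : θ.1 = f - (f - θ.1) := by abel
      conv_lhs => rw [this]
      exact norm_sub_le _ _
    have : (k : ℝ) * ‖M *ᵥ (f - θ.1)‖ ≤ k * (1 + (1 + c * Real.exp B1)) :=
      mul_le_mul_of_nonneg_left h7 k.2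
    linarith
  · rw [le_inv_mul_iff₀ hc]
    linarith
  · rw [← Real.le_log_iff_exp_le θ.2.2.inv.det_pos]
    linarith

/-- If `θ₀` is the strict minimiser of the limiting loss on a closed set, then away from `θ₀` the
empirical losses are eventually uniformly larger than the minimum. -/
theorem exists_eventually_add_le_gaussianLoss {M : Matrix (Fin D) (Fin L) ℝ}
    (hM : Function.Injective M.mulVec) (f : Fin L → ℝ) (S : CovMatrix D)
    {K A : Set (Param L D)} (hK : IsClosed K) (hA : IsOpen A) {θ₀ : Param L D} (hθA : θ₀ ∈ A)
    (hmin : ∀ θ ∈ K, θ ≠ θ₀ → gaussianLoss M f S.1 0 θ₀ < gaussianLoss M f S.1 0 θ) :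
    ∃ δ : ℝ, 0 < δ ∧ ∀ᶠ z in 𝓝 (S.1, (0 : Fin D → ℝ)), z.1.IsHermitian →
      ∀ θ ∈ K \ A, gaussianLoss M f S.1 0 θ₀ + δ ≤ gaussianLoss M f z.1 z.2 θ := by
  set l₀ := gaussianLoss M f S.1 0 θ₀ with hl₀
  have hcont := continuous_gaussianLoss M f
  obtain ⟨Q, hQ, hev⟩ := exists_isCompact_eventually_lt_gaussianLoss hM f S (l₀ + 1)
  have hQK : IsCompact (Q ∩ (K \ A)) := hQ.inter_right (hK.sdiff hA)
  obtain ⟨δ, hδ, hδ'⟩ : ∃ δ : ℝ, 0 < δ ∧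
      ∀ θ ∈ Q ∩ (K \ A), l₀ + δ < gaussianLoss M f S.1 0 θ := by
    rcases (Q ∩ (K \ A)).eq_empty_or_nonempty with hE | hE
    · exact ⟨1, one_pos, by simp [hE]⟩
    · obtain ⟨θ₁, hθ₁, hle⟩ := hQK.exists_isMinOn hE
        (f := fun θ => gaussianLoss M f S.1 0 θ)
        (hcont.comp (Continuous.prodMk_right (S.1, (0 : Fin D → ℝ)))).continuousOn
      have h1 := hmin θ₁ hθ₁.2.1 (fun h => hθ₁.2.2 (h ▸ hθA))
      refine ⟨(gaussianLoss M f S.1 0 θ₁ - l₀) / 2, by linarith, fun θ hθ => ?_⟩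
      have := isMinOn_iff.1 hle θ hθ
      linarith
  have hev2 : ∀ᶠ z in 𝓝 (S.1, (0 : Fin D → ℝ)),
      ∀ θ ∈ Q ∩ (K \ A), l₀ + δ < gaussianLoss M f z.1 z.2 θ :=
    hQK.eventually_forall_of_forall_eventually fun θ hθ =>
      hcont.continuousAt.eventually (lt_mem_nhds (hδ' θ hθ))
  -- `δ` is the gap on the compact set `Q`, and `1` the gap outside it.
  refine ⟨min δ 1, by positivity, ?_⟩
  filter_upwards [hev, hev2] with z h1 h2 hH θ hθ
  by_cases hq : θ ∈ Q
  · linarith [h2 θ ⟨hq, hθ⟩, min_le_left δ 1]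
  · linarith [h1 hH θ hq, min_le_right δ 1]

end Loss

/-! ### Empirical moments as sufficient statistics -/

section EmpiricalMoments

variable {D : ℕ}

noncomputable def empiricalMean (x : ℕ → Fin D → ℝ) (t : ℕ) : Fin D → ℝ :=
  (t : ℝ)⁻¹ • ∑ z ∈ Finset.range t, x z

noncomputable def empiricalCov (x : ℕ → Fin D → ℝ) (t : ℕ) : Matrix (Fin D) (Fin D) ℝ :=
  (t : ℝ)⁻¹ • ∑ z ∈ Finset.range t, vecMulVec (x z) (x z) -
    vecMulVec (empiricalMean x t) (empiricalMean x t)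

theorem isHermitian_empiricalCov (x : ℕ → Fin D → ℝ) (t : ℕ) :
    (empiricalCov x t).IsHermitian := by
  have h : ∀ v : Fin D → ℝ, (vecMulVec v v).IsHermitian := fun v =>
    (posSemidef_vecMulVec_self_star v).1
  have hs : (∑ z ∈ Finset.range t, vecMulVec (x z) (x z)).IsHermitian := by
    rw [IsHermitian, conjTranspose_sum]
    exact Finset.sum_congr rfl fun z _ => h (x z)
  refine IsHermitian.sub ?_ (h _)
  rw [IsHermitian, conjTranspose_smul, hs, star_trivial]

/-- Bias-variance decomposition; it is exact because `empiricalCov` is centred at the empirical mean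
and normalised by `t`. -/
theorem sum_vecMulVec_add_self (x : ℕ → Fin D → ℝ) (u : Fin D → ℝ) {t : ℕ} (ht : t ≠ 0) :
    ∑ z ∈ Finset.range t, vecMulVec (x z + u) (x z + u) =
      (t : ℝ) • (empiricalCov x t +
        vecMulVec (empiricalMean x t + u) (empiricalMean x t + u)) := by
  have ht' : (t : ℝ) ≠ 0 := Nat.cast_ne_zero.2 ht
  have hs : ∑ z ∈ Finset.range t, x z = (t : ℝ) • empiricalMean x t := by
    rw [empiricalMean, smul_smul, mul_inv_cancel₀ ht', one_smul]
  have h1 : ∑ z ∈ Finset.range t, vecMulVec u (x z) = (t : ℝ) • vecMulVec u (empiricalMean x t) := by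
    rw [← vecMulVec_smul, ← hs]
    ext i j
    simp [vecMulVec_apply, Finset.mul_sum, Matrix.sum_apply]
  have h2 : ∑ z ∈ Finset.range t, vecMulVec (x z) u = (t : ℝ) • vecMulVec (empiricalMean x t) u := by
    rw [← smul_vecMulVec, ← hs]
    ext i j
    simp [vecMulVec_apply, Finset.sum_mul, Matrix.sum_apply]
  simp only [add_vecMulVec, vecMulVec_add, Finset.sum_add_distrib, Finset.sum_const,
    Finset.card_range, h1, h2, empiricalCov, smul_add, smul_sub,
    smul_smul, mul_inv_cancel₀ ht', one_smul, ← Nat.cast_smul_eq_nsmul ℝ]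
  abel

variable {L : ℕ}

theorem likelihood_eq_exp (M : Matrix (Fin D) (Fin L) ℝ) (f : Fin L → ℝ) (x : ℕ → Fin D → ℝ)
    {t : ℕ} (ht : t ≠ 0) (θ : Param L D) :
    likelihood M (fun z => M *ᵥ f + x z) t θ =
      Real.exp (-(t / 2) * (Real.log ((2 * Real.pi) ^ D) +
        gaussianLoss M f (empiricalCov x t) (empiricalMean x t) θ)) := by
  have hd := θ.2.det_pos
  have hpi : 0 < (2 * Real.pi) ^ D := by positivity
  have h1 : (Real.sqrt ((2 * Real.pi) ^ D * θ.2.1.det))⁻¹ =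
      Real.exp (-(1 / 2) * (Real.log ((2 * Real.pi) ^ D) + Real.log θ.2.1.det)) := by
    rw [← Real.log_mul hpi.ne' hd.ne', neg_mul, Real.exp_neg, one_div_mul_eq_div,
      ← Real.log_sqrt (by positivity), Real.exp_log (by positivity)]
  have h2 : ∀ z, M *ᵥ f + x z - M *ᵥ θ.1 = x z + M *ᵥ (f - θ.1) := fun z => by
    rw [mulVec_sub]; abel
  have h3 : ∑ z ∈ Finset.range t, (x z + M *ᵥ (f - θ.1)) ⬝ᵥ
      (θ.2.1⁻¹ *ᵥ (x z + M *ᵥ (f - θ.1))) =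
        t * (θ.2.1⁻¹ * (empiricalCov x t + vecMulVec (empiricalMean x t + M *ᵥ (f - θ.1))
          (empiricalMean x t + M *ᵥ (f - θ.1)))).trace := by
    simp only [← trace_mul_vecMulVec]
    rw [← trace_sum, ← Matrix.mul_sum, sum_vecMulVec_add_self x _ ht, Matrix.mul_smul, trace_smul,
      smul_eq_mul]
  simp only [likelihood, normalDensity, h1, h2]
  rw [Finset.prod_mul_distrib, Finset.prod_const, Finset.card_range, ← Real.exp_sum,
    ← Real.exp_nat_mul, ← Real.exp_add, ← Finset.mul_sum, h3, gaussianLoss]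
  congr 1
  ring

end EmpiricalMoments

/-! ### Concentration of the posterior for a fixed signal path -/

section Concentration

variable {L D : ℕ}

instance CovMatrix.secondCountableTopology : SecondCountableTopology (CovMatrix D) :=
  haveI : SecondCountableTopology (Matrix (Fin D) (Fin D) ℝ) :=
    inferInstanceAs (SecondCountableTopology (Fin D → Fin D → ℝ))
  TopologicalSpace.Subtype.secondCountableTopology {S : Matrix (Fin D) (Fin D) ℝ | S.PosDef}

/-- Bounds the likelihood uniformly in `θ`, which makes the normalising integral finite. -/
theorem exists_eventually_le_gaussianLoss (M : Matrix (Fin D) (Fin L) ℝ) (f : Fin L → ℝ)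
    (S : CovMatrix D) :
    ∃ B : ℝ, ∀ᶠ z in 𝓝 (S.1, (0 : Fin D → ℝ)), z.1.IsHermitian →
      ∀ θ, B ≤ gaussianLoss M f z.1 z.2 θ := by
  obtain ⟨c', hc', hev⟩ := S.2.exists_eventually_sub_smul_one_posDef
  obtain ⟨c, rfl⟩ : ∃ c, c' = 2 * c := ⟨c' / 2, by ring⟩
  have hc : 0 < c := by linarith
  refine ⟨D * Real.log c + D, ?_⟩
  filter_upwards [continuous_fst.continuousAt.eventually hev] with z hz hH θ
  have hl := gaussianLoss_lower_bound M f hc (hz hH).posSemidef z.2 θ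
  set v := z.2 + M *ᵥ (f - θ.1)
  have hvv : 0 ≤ v ⬝ᵥ v := by simpa using dotProduct_star_self_nonneg v
  have hlog : 0 ≤ Real.log (1 + c⁻¹ * (v ⬝ᵥ v)) := Real.log_nonneg (by
    have : 0 ≤ c⁻¹ * (v ⬝ᵥ v) := by positivity
    linarith)
  have htr : 0 ≤ c * θ.2.1⁻¹.trace := mul_nonneg hc.le θ.2.2.inv.posSemidef.trace_nonneg
  linarith

/-- Disjoint neighbourhoods of two such points would have total posterior mass tending to `2`. -/
theorem ConcentratesOn.eq {M : Matrix (Fin D) (Fin L) ℝ} {P₀ : Measure (Param L D)}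
    {r : ℕ → Fin D → ℝ} {θ θ' : Param L D} (h : ConcentratesOn M P₀ r θ)
    (h' : ConcentratesOn M P₀ r θ') : θ' = θ := by
  by_contra hne
  obtain ⟨U, V, hU, hV, hθU, hθV, hUV⟩ := t2_separation hne
  have hle : ∀ t, posterior M P₀ r t U + posterior M P₀ r t V ≤ 1 := fun t => by
    rw [_root_.posterior, _root_.posterior, ← ENNReal.add_div, ← lintegral_union hV.measurableSet hUV]
    exact (ENNReal.div_le_div_right (setLIntegral_le_lintegral _ _) _).trans
      ENNReal.div_self_le_one
  have hlim := le_of_tendsto' ((h' U hU hθU).add (h V hV hθV)) hle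
  norm_num at hlim

/-- Deterministic version of the concentration of beliefs: it suffices that the empirical moments
converge, and that `θ₀` is the strict minimiser of the limiting loss on the support. -/
theorem concentratesOn_of_tendsto {M : Matrix (Fin D) (Fin L) ℝ}
    (hM : Function.Injective M.mulVec) (f : Fin L → ℝ) (S : CovMatrix D)
    {P₀ : Measure (Param L D)} [IsProbabilityMeasure P₀] {θ₀ : Param L D} (hθ₀ : θ₀ ∈ P₀.support)
    (hmin : ∀ θ ∈ P₀.support, θ ≠ θ₀ →
      gaussianLoss M f S.1 0 θ₀ < gaussianLoss M f S.1 0 θ)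
    {x : ℕ → Fin D → ℝ} (hmean : Tendsto (empiricalMean x) atTop (𝓝 0))
    (hcov : Tendsto (empiricalCov x) atTop (𝓝 S.1)) :
    ConcentratesOn M P₀ (fun z => M *ᵥ f + x z) θ₀ := by
  intro A hA hθA
  set l₀ := gaussianLoss M f S.1 0 θ₀ with hl₀
  set κ := Real.log ((2 * Real.pi) ^ D) with hκ
  set ℓ : ℕ → Param L D → ℝ≥0∞ := fun t θ =>
    ENNReal.ofReal (likelihood M (fun z => M *ᵥ f + x z) t θ) with hℓ
  have hz : Tendsto (fun t => (empiricalCov x t, empiricalMean x t)) atTop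
      (𝓝 (S.1, (0 : Fin D → ℝ))) := hcov.prodMk_nhds hmean
  obtain ⟨δ, hδ, hev⟩ := exists_eventually_add_le_gaussianLoss hM f S
    (Measure.isClosed_support (μ := P₀)) hA hθA hmin
  have hnear : ∀ᶠ z in 𝓝 (S.1, (0 : Fin D → ℝ)) ×ˢ 𝓝 θ₀,
      gaussianLoss M f z.1.1 z.1.2 z.2 < l₀ + δ / 2 := by
    rw [← nhds_prod_eq]
    exact (continuous_gaussianLoss M f).continuousAt.eventually (gt_mem_nhds (by
      simp only [← hl₀]; linarith))
  obtain ⟨pz, hpz, pθ, hpθ, hp⟩ := eventually_prod_iff.1 hnear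
  obtain ⟨U, hUp, hU, hθU⟩ := mem_nhds_iff.1 hpθ
  have hUpos : 0 < P₀ U := (Measure.mem_support_iff_forall _).1 hθ₀ _ (hU.mem_nhds hθU)
  obtain ⟨B, hB⟩ := exists_eventually_le_gaussianLoss M f S
  have hae : ∀ᵐ θ ∂P₀, θ ∈ P₀.support := Measure.support_mem_ae
  -- Laplace's method: near `θ₀`, on `U` of positive prior mass, the loss is below `l₀ + δ / 2`; on
  -- the support outside `A` it is at least `l₀ + δ`. Hence `Aᶜ` has posterior mass at most `exp (-t
  -- δ / 4) / P₀ U`.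
  have hbounds : ∀ᶠ t : ℕ in atTop,
      ENNReal.ofReal (Real.exp (-(t / 2) * (κ + (l₀ + δ / 2)))) * P₀ U ≤ ∫⁻ θ, ℓ t θ ∂P₀ ∧
      ∫⁻ θ in Aᶜ, ℓ t θ ∂P₀ ≤ ENNReal.ofReal (Real.exp (-(t / 2) * (κ + (l₀ + δ)))) ∧
      ∫⁻ θ, ℓ t θ ∂P₀ ≠ ∞ := by
    filter_upwards [hz.eventually hev, hz.eventually hpz, hz.eventually hB,
      eventually_ne_atTop 0] with t h1 h2 h3 ht
    have hH := isHermitian_empiricalCov x t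
    have hexp : ∀ {a b : ℝ}, a ≤ b → ENNReal.ofReal (Real.exp (-(t / 2) * (κ + b))) ≤
        ENNReal.ofReal (Real.exp (-(t / 2) * (κ + a))) := fun hab => by
      have : (0 : ℝ) ≤ t := t.cast_nonneg
      exact ENNReal.ofReal_le_ofReal (Real.exp_le_exp.2 (by nlinarith))
    simp only [hℓ, likelihood_eq_exp M f x ht]
    refine ⟨?_, ?_, ?_⟩
    · rw [← setLIntegral_const]
      exact (setLIntegral_mono' hU.measurableSet fun θ hθ => hexp (hp h2 (hUp hθ)).le).trans
        (setLIntegral_le_lintegral U _)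
    · refine (setLIntegral_mono_ae' (g := fun _ =>
        ENNReal.ofReal (Real.exp (-(t / 2) * (κ + (l₀ + δ))))) hA.measurableSet.compl ?_).trans ?_
      · filter_upwards [hae] with θ hθ hθA
        exact hexp (h1 hH θ ⟨hθ, hθA⟩)
      · rw [setLIntegral_const]
        exact mul_le_of_le_one_right' prob_le_one
    · refine ne_top_of_le_ne_top (b := ENNReal.ofReal (Real.exp (-(t / 2) * (κ + B))))
        ENNReal.ofReal_ne_top ((lintegral_mono fun θ => hexp (h3 hH θ)).trans ?_)
      simp
  have hratio : Tendsto (fun t : ℕ => 1 - ENNReal.ofReal (Real.exp (-(t / 2) * (δ / 2))) / P₀ U)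
      atTop (𝓝 1) := by
    have h1 : Tendsto (fun t : ℕ => Real.exp (-(t / 2) * (δ / 2))) atTop (𝓝 0) := by
      refine Real.tendsto_exp_atBot.comp ?_
      have : Tendsto (fun t : ℕ => (δ / 4) * (t : ℝ)) atTop atTop :=
        tendsto_natCast_atTop_atTop.const_mul_atTop (by positivity)
      refine (tendsto_neg_atTop_atBot.comp this).congr fun t => ?_
      simp only [Function.comp]
      ring
    have h2 := ENNReal.Tendsto.div_const (ENNReal.tendsto_ofReal h1) (b := P₀ U)
      (Or.inr hUpos.ne')
    simpa using ENNReal.Tendsto.sub tendsto_const_nhds h2 (Or.inl ENNReal.one_ne_top)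
  refine tendsto_of_tendsto_of_tendsto_of_le_of_le' hratio tendsto_const_nhds ?_
    (Eventually.of_forall fun t => (ENNReal.div_le_div_right (setLIntegral_le_lintegral _ _) _).trans
      ENNReal.div_self_le_one)
  filter_upwards [hbounds] with t ht
  obtain ⟨hlow, hup, hfin⟩ := ht
  have hcpos : 0 < ENNReal.ofReal (Real.exp (-(t / 2) * (κ + (l₀ + δ / 2)))) :=
    ENNReal.ofReal_pos.2 (Real.exp_pos _)
  have hZ : ∫⁻ θ, ℓ t θ ∂P₀ ≠ 0 :=
    ((ENNReal.mul_pos hcpos.ne' hUpos.ne').trans_le hlow).ne'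
  have hadd := lintegral_add_compl (μ := P₀) (ℓ t) hA.measurableSet
  have hone : (∫⁻ θ in A, ℓ t θ ∂P₀) / (∫⁻ θ, ℓ t θ ∂P₀) +
      (∫⁻ θ in Aᶜ, ℓ t θ ∂P₀) / (∫⁻ θ, ℓ t θ ∂P₀) = 1 := by
    rw [← ENNReal.add_div, hadd, ENNReal.div_self hZ hfin]
  have hsmall : (∫⁻ θ in Aᶜ, ℓ t θ ∂P₀) / (∫⁻ θ, ℓ t θ ∂P₀) ≤
      ENNReal.ofReal (Real.exp (-(t / 2) * (δ / 2))) / P₀ U := by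
    refine (ENNReal.div_le_div hup hlow).trans_eq ?_
    have : Real.exp (-(t / 2) * (κ + (l₀ + δ))) =
        Real.exp (-(t / 2) * (κ + (l₀ + δ / 2))) * Real.exp (-(t / 2) * (δ / 2)) := by
      rw [← Real.exp_add]; congr 1; ring
    rw [this, ENNReal.ofReal_mul (Real.exp_pos _).le,
      ENNReal.mul_div_mul_left _ _ hcpos.ne' ENNReal.ofReal_ne_top]
  rw [tsub_le_iff_right]
  exact hone.symm.le.trans (add_le_add_right hsmall _)

end Concentration

/-! ### Almost sure convergence of the empirical moments -/

section StrongLaw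

variable {Ω : Type*} [MeasurableSpace Ω] {P : Measure Ω}

theorem ae_tendsto_average_of_hasLaw {E : Type*} [MeasurableSpace E] {μ : Measure E}
    {ε : ℕ → Ω → E} (hlaw : ∀ t, HasLaw (ε t) μ P) (hindep : iIndepFun ε P)
    {g : E → ℝ} (hg : Measurable g) (hint : Integrable g μ) :
    ∀ᵐ ω ∂P, Tendsto (fun t : ℕ => (t : ℝ)⁻¹ * ∑ z ∈ Finset.range t, g (ε z ω)) atTop
      (𝓝 (∫ x, g x ∂μ)) := by
  have h0 : ∫ ω, g (ε 0 ω) ∂P = ∫ x, g x ∂μ := (hlaw 0).integral_comp hg.aestronglyMeasurable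
  have hint' : Integrable (fun ω => g (ε 0 ω)) P := by
    rw [← (hlaw 0).map_eq] at hint
    exact hint.comp_aemeasurable (hlaw 0).aemeasurable
  have h := strong_law_ae_real (fun t ω => g (ε t ω)) hint'
    (fun s t hst => (hindep.indepFun hst).comp hg hg)
    (fun t => IdentDistrib.comp ⟨(hlaw t).aemeasurable, (hlaw 0).aemeasurable,
      (hlaw t).map_eq.trans (hlaw 0).map_eq.symm⟩ hg)
  rw [h0] at h
  filter_upwards [h] with ω hω
  simpa only [div_eq_inv_mul] using hω

variable {D : ℕ}

theorem memLp_eval_multivariateGaussian (S : Matrix (Fin D) (Fin D) ℝ) (j : Fin D) :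
    MemLp (fun x : EuclideanSpace ℝ (Fin D) => x j) 2 (multivariateGaussian 0 S) :=
  IsGaussian.memLp_dual (multivariateGaussian 0 S) (EuclideanSpace.proj j) 2 (by simp)

theorem integral_eval_multivariateGaussian (S : Matrix (Fin D) (Fin D) ℝ) (j : Fin D) :
    ∫ x, x j ∂(multivariateGaussian 0 S) = 0 := by
  have h := (EuclideanSpace.proj (𝕜 := ℝ) j).integral_comp_comm
    (μ := multivariateGaussian 0 S) (φ := fun x : EuclideanSpace ℝ (Fin D) => x)
    IsGaussian.integrable_id
  rw [integral_id_multivariateGaussian] at h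
  simpa using h

theorem integral_mul_eval_multivariateGaussian {S : Matrix (Fin D) (Fin D) ℝ}
    (hS : S.PosSemidef) (j k : Fin D) :
    ∫ x, x j * x k ∂(multivariateGaussian 0 S) = S j k := by
  have h := covariance_eq_sub (memLp_eval_multivariateGaussian S j)
    (memLp_eval_multivariateGaussian S k)
  rw [covariance_eval_multivariateGaussian hS, integral_eval_multivariateGaussian] at h
  simpa using h.symm

theorem ae_tendsto_empirical_moments {S : Matrix (Fin D) (Fin D) ℝ} (hS : S.PosSemidef)
    {ε : ℕ → Ω → EuclideanSpace ℝ (Fin D)}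
    (hlaw : ∀ t, HasLaw (ε t) (multivariateGaussian 0 S) P) (hindep : iIndepFun ε P) :
    ∀ᵐ ω ∂P, Tendsto (empiricalMean fun t => (ε t ω).ofLp) atTop (𝓝 0) ∧
      Tendsto (empiricalCov fun t => (ε t ω).ofLp) atTop (𝓝 S) := by
  have h1 := ae_all_iff.2 fun j => ae_tendsto_average_of_hasLaw hlaw hindep
    (g := fun x => x j) (by fun_prop)
    ((memLp_eval_multivariateGaussian S j).integrable (by norm_num))
  have h2 := ae_all_iff.2 fun j => ae_all_iff.2 fun k => ae_tendsto_average_of_hasLaw hlaw hindep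
    (g := fun x => x j * x k) (by fun_prop)
    ((memLp_eval_multivariateGaussian S j).integrable_mul (memLp_eval_multivariateGaussian S k))
  simp only [integral_eval_multivariateGaussian] at h1
  simp only [integral_mul_eval_multivariateGaussian hS] at h2
  filter_upwards [h1, h2] with ω hω1 hω2
  have hmean : Tendsto (empiricalMean fun t => (ε t ω).ofLp) atTop (𝓝 0) := by
    refine tendsto_pi_nhds.2 fun j => (hω1 j).congr fun t => ?_
    simp [empiricalMean]
  refine ⟨hmean, ?_⟩
  refine tendsto_pi_nhds.2 fun j => tendsto_pi_nhds.2 fun k => ?_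
  have hm := fun j => tendsto_pi_nhds.1 hmean j
  have h := (hω2 j k).sub ((hm j).mul (hm k))
  simp only [Pi.zero_apply, mul_zero, sub_zero] at h
  refine h.congr fun t => ?_
  simp [empiricalCov, vecMulVec_apply, Matrix.sum_apply]

end StrongLaw

/-! ### Reduction to strict minimisation of the limiting loss -/

section LongRun

variable {L D : ℕ} {Ω : Type*} [MeasurableSpace Ω] {P : Measure Ω}

theorem isLongRunBelief_of_forall_lt {M : Matrix (Fin D) (Fin L) ℝ}
    (hM : Function.Injective M.mulVec) {f : Fin L → ℝ} {S : CovMatrix D}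
    {ε : ℕ → Ω → EuclideanSpace ℝ (Fin D)}
    (hlaw : ∀ t, HasLaw (ε t) (multivariateGaussian 0 S.1) P) (hindep : iIndepFun ε P)
    {P₀ : Measure (Param L D)} [IsProbabilityMeasure P₀] {θ₀ : Param L D} (hθ₀ : θ₀ ∈ P₀.support)
    (hmin : ∀ θ ∈ P₀.support, θ ≠ θ₀ →
      gaussianLoss M f S.1 0 θ₀ < gaussianLoss M f S.1 0 θ) :
    IsLongRunBelief P M f ε P₀ θ₀ := by
  filter_upwards [ae_tendsto_empirical_moments S.2.posSemidef hlaw hindep] with ω hω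
  have h : ConcentratesOn M P₀ (signal M f ε ω) θ₀ :=
    concentratesOn_of_tendsto hM f S hθ₀ hmin hω.1 hω.2
  exact fun θ' => ⟨fun h' => h.eq h', fun h' => h' ▸ h⟩

end LongRun

/-! ### Minimisers of the limiting loss -/

section Minimisation

variable {L D : ℕ}

theorem Matrix.mulVec_injective_of_rank_eq {M : Matrix (Fin D) (Fin L) ℝ} (hM : M.rank = L) :
    Function.Injective M.mulVec := by
  have h := M.mulVecLin.finrank_range_add_finrank_ker
  rw [← Matrix.rank, hM, Module.finrank_fin_fun] at h
  exact LinearMap.ker_eq_bot.1 (Submodule.finrank_eq_zero.1 (by omega) :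
    LinearMap.ker M.mulVecLin = ⊥)

/-- On the hyperplane `d i = c`, a positive definite quadratic form has a unique minimiser, which
is a multiple of the `i`-th column of the inverse matrix. -/
theorem Matrix.PosDef.dotProduct_mulVec_lt {n : Type*} [Fintype n] [DecidableEq n]
    {A : Matrix n n ℝ} (hA : A.PosDef) (i : n) {c : ℝ} {d₀ d : n → ℝ}
    (hd₀ : ∀ j, d₀ j = A⁻¹ j i / A⁻¹ i i * c) (hd : d i = c) (hne : d ≠ d₀) :
    d₀ ⬝ᵥ (A *ᵥ d₀) < d ⬝ᵥ (A *ᵥ d) := by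
  have hii : 0 < A⁻¹ i i := hA.inv.diag_pos
  have hd₀' : d₀ = (c / A⁻¹ i i) • (A⁻¹ *ᵥ Pi.single i 1) := by
    ext j
    simp [hd₀]
    ring
  -- The Lagrange condition: the gradient at `d₀` is normal to the hyperplane, so the cross terms
  -- with `h` vanish.
  have hAd₀ : A *ᵥ d₀ = (c / A⁻¹ i i) • Pi.single i 1 := by
    rw [hd₀', mulVec_smul, mulVec_mulVec,
      mul_nonsing_inv _ ((isUnit_iff_isUnit_det _).1 hA.isUnit), one_mulVec]
  have hi : d₀ i = c := by rw [hd₀, div_self hii.ne', one_mul]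
  set h := d - d₀ with hh
  have hhi : h i = 0 := by simp [hh, hd, hi]
  have hcross : h ⬝ᵥ (A *ᵥ d₀) = 0 := by
    rw [hAd₀, dotProduct_smul, dotProduct_single_one, hhi, smul_zero]
  have hsymm : Aᵀ = A := by simpa using hA.1.eq
  have hcross' : d₀ ⬝ᵥ (A *ᵥ h) = 0 := by
    rw [dotProduct_mulVec, ← mulVec_transpose, hsymm, dotProduct_comm, hcross]
  have hpos : 0 < h ⬝ᵥ (A *ᵥ h) := by
    simpa only [star_trivial] using hA.dotProduct_mulVec_pos (sub_ne_zero.2 hne)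
  have hdd : d = d₀ + h := by rw [hh]; abel
  rw [hdd, mulVec_add, add_dotProduct, dotProduct_add, dotProduct_add, hcross, hcross']
  linarith

theorem dotProduct_mulVec_mulVec (M : Matrix (Fin D) (Fin L) ℝ) (A : Matrix (Fin D) (Fin D) ℝ)
    (d : Fin L → ℝ) :
    (M *ᵥ d) ⬝ᵥ (A *ᵥ (M *ᵥ d)) = d ⬝ᵥ ((Mᵀ * A * M) *ᵥ d) := by
  rw [← mulVec_mulVec, ← mulVec_mulVec, dotProduct_mulVec d Mᵀ, vecMul_transpose]

theorem posDef_transpose_mul_inv_mul {M : Matrix (Fin D) (Fin L) ℝ}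
    (hM : Function.Injective M.mulVec) (Q : CovMatrix D) : (Mᵀ * Q.1⁻¹ * M).PosDef := by
  simpa using Q.2.inv.conjTranspose_mul_mul_same hM

theorem gaussianLoss_zero (M : Matrix (Fin D) (Fin L) ℝ) (f : Fin L → ℝ)
    (C : Matrix (Fin D) (Fin D) ℝ) (θ : Param L D) :
    gaussianLoss M f C 0 θ = Real.log θ.2.1.det +
      (θ.2.1⁻¹ * (C + vecMulVec (M *ᵥ (θ.1 - f)) (M *ᵥ (θ.1 - f)))).trace := by
  have : M *ᵥ (f - θ.1) = -(M *ᵥ (θ.1 - f)) := by rw [← mulVec_neg, neg_sub]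
  rw [gaussianLoss, zero_add, this, neg_vecMulVec, vecMulVec_neg, neg_neg]

theorem gaussianLoss_zero_eq_add (M : Matrix (Fin D) (Fin L) ℝ) (f : Fin L → ℝ)
    (C : Matrix (Fin D) (Fin D) ℝ) (θ : Param L D) :
    gaussianLoss M f C 0 θ = Real.log θ.2.1.det + (θ.2.1⁻¹ * C).trace +
      (θ.1 - f) ⬝ᵥ ((Mᵀ * θ.2.1⁻¹ * M) *ᵥ (θ.1 - f)) := by
  rw [gaussianLoss_zero, Matrix.mul_add, trace_add, trace_mul_vecMulVec, dotProduct_mulVec_mulVec,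
    add_assoc]

/-- The covariance matrix `S + v vᵀ`, where `v = M (f' - f)`, that best explains the signals when
the fundamentals are believed to be `f'`. -/
def misspecifiedCov (M : Matrix (Fin D) (Fin L) ℝ) (f : Fin L → ℝ) (S : CovMatrix D)
    (f' : Fin L → ℝ) : CovMatrix D :=
  ⟨S.1 + vecMulVec (M *ᵥ (f' - f)) (M *ᵥ (f' - f)), S.2.add_vecMulVec_self _⟩

theorem gaussianLoss_misspecifiedCov (M : Matrix (Fin D) (Fin L) ℝ) (f : Fin L → ℝ)
    (S : CovMatrix D) (f' : Fin L → ℝ) :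
    gaussianLoss M f S.1 0 (f', misspecifiedCov M f S f') =
      Real.log (misspecifiedCov M f S f').1.det + D := by
  have h : (misspecifiedCov M f S f').1⁻¹ * (misspecifiedCov M f S f').1 = 1 :=
    nonsing_inv_mul _ ((isUnit_iff_isUnit_det _).1 (misspecifiedCov M f S f').2.isUnit)
  rw [gaussianLoss_zero]
  dsimp only
  rw [show S.1 + vecMulVec (M *ᵥ (f' - f)) (M *ᵥ (f' - f)) = (misspecifiedCov M f S f').1 from rfl,
    h, trace_one, Fintype.card_fin]

/-- For fixed fundamentals, this is Stein's inequality with `T = misspecifiedCov M f S θ.1`. -/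
theorem gaussianLoss_misspecifiedCov_le (M : Matrix (Fin D) (Fin L) ℝ) (f : Fin L → ℝ)
    (S : CovMatrix D) (θ : Param L D) :
    gaussianLoss M f S.1 0 (θ.1, misspecifiedCov M f S θ.1) ≤ gaussianLoss M f S.1 0 θ := by
  rw [gaussianLoss_misspecifiedCov, gaussianLoss_zero]
  have h := (θ.2.2.log_det_add_card_le (misspecifiedCov M f S θ.1).2).1
  rwa [Fintype.card_fin] at h

theorem gaussianLoss_misspecifiedCov_lt (M : Matrix (Fin D) (Fin L) ℝ) (f : Fin L → ℝ)
    (S : CovMatrix D) {θ : Param L D} (hθ : θ.2 ≠ misspecifiedCov M f S θ.1) :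
    gaussianLoss M f S.1 0 (θ.1, misspecifiedCov M f S θ.1) < gaussianLoss M f S.1 0 θ := by
  refine lt_of_not_ge fun h => hθ (Subtype.ext ?_)
  rw [gaussianLoss_misspecifiedCov, gaussianLoss_zero] at h
  exact (θ.2.2.log_det_add_card_le (misspecifiedCov M f S θ.1).2).2 (by rwa [Fintype.card_fin])

/-- After optimising over covariances, the loss depends on `f'` only through the quadratic form
weighted by the true covariance `S`. -/
theorem det_misspecifiedCov (M : Matrix (Fin D) (Fin L) ℝ) (f : Fin L → ℝ) (S : CovMatrix D)
    (f' : Fin L → ℝ) :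
    (misspecifiedCov M f S f').1.det =
      S.1.det * (1 + (f' - f) ⬝ᵥ ((Mᵀ * S.1⁻¹ * M) *ᵥ (f' - f))) := by
  rw [← dotProduct_mulVec_mulVec]
  exact det_add_vecMulVec ((isUnit_iff_isUnit_det _).1 S.2.isUnit) _ _

/-- The long-run belief about the fundamentals when the `i`-th one is believed to be `fi` and the
covariance matrix to be `Q`. -/
noncomputable def longRunFundamentals (M : Matrix (Fin D) (Fin L) ℝ) (f : Fin L → ℝ)
    (Q : CovMatrix D) (i : Fin L) (fi : ℝ) : Fin L → ℝ :=
  fun j => f j + (Mᵀ * Q.1⁻¹ * M)⁻¹ j i / (Mᵀ * Q.1⁻¹ * M)⁻¹ i i * (fi - f i)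

theorem longRunFundamentals_sub (M : Matrix (Fin D) (Fin L) ℝ) (f : Fin L → ℝ)
    (Q : CovMatrix D) (i : Fin L) (fi : ℝ) (j : Fin L) :
    longRunFundamentals M f Q i fi j - f j =
      (Mᵀ * Q.1⁻¹ * M)⁻¹ j i / (Mᵀ * Q.1⁻¹ * M)⁻¹ i i * (fi - f i) := by
  simp [longRunFundamentals]

theorem longRunFundamentals_self {M : Matrix (Fin D) (Fin L) ℝ}
    (hM : Function.Injective M.mulVec) (f : Fin L → ℝ) (Q : CovMatrix D) (i : Fin L) (fi : ℝ) :
    longRunFundamentals M f Q i fi i = fi := by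
  have hii : 0 < (Mᵀ * Q.1⁻¹ * M)⁻¹ i i := (posDef_transpose_mul_inv_mul hM Q).inv.diag_pos
  rw [longRunFundamentals, div_self hii.ne']
  ring

theorem longRunFundamentals_quadForm_lt {M : Matrix (Fin D) (Fin L) ℝ}
    (hM : Function.Injective M.mulVec) (f : Fin L → ℝ) (Q : CovMatrix D) {i : Fin L} {fi : ℝ}
    {f' : Fin L → ℝ} (hi : f' i = fi) (hne : f' ≠ longRunFundamentals M f Q i fi) :
    (longRunFundamentals M f Q i fi - f) ⬝ᵥ
        ((Mᵀ * Q.1⁻¹ * M) *ᵥ (longRunFundamentals M f Q i fi - f)) <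
      (f' - f) ⬝ᵥ ((Mᵀ * Q.1⁻¹ * M) *ᵥ (f' - f)) :=
  (posDef_transpose_mul_inv_mul hM Q).dotProduct_mulVec_lt i (c := fi - f i)
    (longRunFundamentals_sub M f Q i fi) (by simp [hi])
    (fun h => hne (sub_left_injective h))

theorem gaussianLoss_longRunFundamentals_misspecifiedCov_lt {M : Matrix (Fin D) (Fin L) ℝ}
    (hM : Function.Injective M.mulVec) (f : Fin L → ℝ) (S : CovMatrix D) {i : Fin L} {fi : ℝ}
    {θ : Param L D} (hi : θ.1 i = fi)
    (hne : θ ≠ (longRunFundamentals M f S i fi,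
      misspecifiedCov M f S (longRunFundamentals M f S i fi))) :
    gaussianLoss M f S.1 0 (longRunFundamentals M f S i fi,
      misspecifiedCov M f S (longRunFundamentals M f S i fi)) < gaussianLoss M f S.1 0 θ := by
  by_cases h1 : θ.1 = longRunFundamentals M f S i fi
  · rw [← h1] at hne ⊢
    exact gaussianLoss_misspecifiedCov_lt M f S fun h2 => hne (Prod.ext rfl h2)
  · refine lt_of_lt_of_le ?_ (gaussianLoss_misspecifiedCov_le M f S θ)
    rw [gaussianLoss_misspecifiedCov, gaussianLoss_misspecifiedCov]
    have hdet := longRunFundamentals_quadForm_lt hM f S hi h1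
    have hlt : (misspecifiedCov M f S (longRunFundamentals M f S i fi)).1.det <
        (misspecifiedCov M f S θ.1).1.det := by
      rw [det_misspecifiedCov, det_misspecifiedCov]
      exact mul_lt_mul_of_pos_left (by linarith) S.det_pos
    have := Real.log_lt_log (CovMatrix.det_pos _) hlt
    linarith

end Minimisation

theorem theorem1 {L D : ℕ} (M : Matrix (Fin D) (Fin L) ℝ) (hM : M.rank = L)
    (f : Fin L → ℝ) (S : CovMatrix D)
    {Ω : Type*} [MeasurableSpace Ω] (P : Measure Ω) [IsProbabilityMeasure P]
    (ε : ℕ → Ω → EuclideanSpace ℝ (Fin D))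
    (hlaw : ∀ t, HasLaw (ε t) (multivariateGaussian 0 S.1) P)
    (hindep : iIndepFun ε P)
    (i : Fin L) (fi : ℝ) :
    -- Case I: covariance matrix fixed at `S'`, all fundamentals other than `i` uncertain
    (∀ (S' : CovMatrix D) (P₀ : Measure (Param L D)) [IsProbabilityMeasure P₀],
      P₀.support = {θ | θ.1 i = fi ∧ θ.2 = S'} →
      ∃ θ : Param L D, IsLongRunBelief P M f ε P₀ θ ∧ θ.2 = S' ∧ θ.1 i = fi ∧
        ∀ j, θ.1 j - f j =
          (Mᵀ * S'.1⁻¹ * M)⁻¹ i j / (Mᵀ * S'.1⁻¹ * M)⁻¹ i i * (fi - f i)) ∧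
    -- Case II: all fundamentals fixed at `f'`, covariance matrix uncertain
    (∀ (f' : Fin L → ℝ) (P₀ : Measure (Param L D)) [IsProbabilityMeasure P₀],
      P₀.support = {θ | θ.1 = f'} →
      ∃ θ : Param L D, IsLongRunBelief P M f ε P₀ θ ∧ θ.1 = f' ∧
        θ.2.1 - S.1 = Matrix.vecMulVec (M *ᵥ (f' - f)) (M *ᵥ (f' - f))) ∧
    -- Case III: fundamentals other than `i` and covariance matrix uncertain
    (∀ (P₀ : Measure (Param L D)) [IsProbabilityMeasure P₀],
      P₀.support = {θ | θ.1 i = fi} →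
      ∃ θ : Param L D, IsLongRunBelief P M f ε P₀ θ ∧ θ.1 i = fi ∧
        (∀ j, θ.1 j - f j =
          (Mᵀ * S.1⁻¹ * M)⁻¹ j i / (Mᵀ * S.1⁻¹ * M)⁻¹ i i * (fi - f i)) ∧
        θ.2.1 - S.1 = Matrix.vecMulVec (M *ᵥ (θ.1 - f)) (M *ᵥ (θ.1 - f))) ∧
    -- the long-run fundamentals in Case III are those of Case I with the true covariance matrix
    (∀ (P₀ P₁ : Measure (Param L D)) [IsProbabilityMeasure P₀] [IsProbabilityMeasure P₁],
      P₀.support = {θ | θ.1 i = fi} →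
      P₁.support = {θ | θ.1 i = fi ∧ θ.2 = S} →
      ∃ θ₀ θ₁ : Param L D, IsLongRunBelief P M f ε P₀ θ₀ ∧ IsLongRunBelief P M f ε P₁ θ₁ ∧
        θ₀.1 = θ₁.1) := by
  have hinj := Matrix.mulVec_injective_of_rank_eq hM
  have hfixedCov : ∀ (S' : CovMatrix D) (P₀ : Measure (Param L D)) [IsProbabilityMeasure P₀],
      P₀.support = {θ | θ.1 i = fi ∧ θ.2 = S'} →
      IsLongRunBelief P M f ε P₀ (longRunFundamentals M f S' i fi, S') := by
    intro S' P₀ _ hsupp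
    refine isLongRunBelief_of_forall_lt hinj hlaw hindep ?_ ?_
    · rw [hsupp]
      exact ⟨longRunFundamentals_self hinj f S' i fi, rfl⟩
    · rw [hsupp]
      rintro ⟨f', Q⟩ ⟨hi, rfl⟩ hne
      have h := longRunFundamentals_quadForm_lt hinj f Q hi fun h => hne (Prod.ext h rfl)
      simpa only [gaussianLoss_zero_eq_add, add_lt_add_iff_left] using h
  have hfree : ∀ (P₀ : Measure (Param L D)) [IsProbabilityMeasure P₀],
      P₀.support = {θ | θ.1 i = fi} →
      IsLongRunBelief P M f ε P₀ (longRunFundamentals M f S i fi,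
        misspecifiedCov M f S (longRunFundamentals M f S i fi)) := by
    intro P₀ _ hsupp
    refine isLongRunBelief_of_forall_lt hinj hlaw hindep ?_ ?_
    · rw [hsupp]
      exact longRunFundamentals_self hinj f S i fi
    · rw [hsupp]
      exact fun θ hi hne => gaussianLoss_longRunFundamentals_misspecifiedCov_lt hinj f S hi hne
  refine ⟨fun S' P₀ _ hsupp => ⟨_, hfixedCov S' P₀ hsupp, rfl,
    longRunFundamentals_self hinj f S' i fi, fun j => ?_⟩, fun f' P₀ _ hsupp => ?_,
    fun P₀ _ hsupp => ⟨_, hfree P₀ hsupp, longRunFundamentals_self hinj f S i fi,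
      longRunFundamentals_sub M f S i fi, add_sub_cancel_left _ _⟩,
    fun P₀ P₁ _ _ h₀ h₁ => ⟨_, _, hfree P₀ h₀, hfixedCov S P₁ h₁, rfl⟩⟩
  -- Case I is stated with the entry `i j`, whereas `longRunFundamentals` uses `j i`.
  · have hsymm : (Mᵀ * S'.1⁻¹ * M)⁻¹ i j = (Mᵀ * S'.1⁻¹ * M)⁻¹ j i := by
      simpa using (posDef_transpose_mul_inv_mul hinj S').inv.1.apply j i
    rw [hsymm]
    exact longRunFundamentals_sub M f S' i fi j
  · refine ⟨(f', misspecifiedCov M f S f'),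
      isLongRunBelief_of_forall_lt hinj hlaw hindep (by rw [hsupp]; rfl) ?_, rfl,
      add_sub_cancel_left _ _⟩
    rw [hsupp]
    rintro ⟨f'', Q⟩ rfl hne
    exact gaussianLoss_misspecifiedCov_lt M f S (θ := (f'', Q)) fun h => hne (Prod.ext rfl h)
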